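/- **Definitions.** An *abstract logic* $\mathcal L$ consists of a set $Expr_{\mathcal L}$ of expressions, a non-empty set $Th_{\mathcal L}$ of subsets of $Expr_{\mathcal L}$ (the *theories*) such that $\bigcap\mathcal T\in Th_{\mathcal L}$ for every non-empty $\mathcal T\subseteq Th_{\mathcal L}$, and a set of operations on $Expr_{\mathcal L}$ (the connectives). A theory $T$ is *totally prime* if, for every non-empty $\mathcal T\subseteq Th_{\mathcal L}$, $T=\bigcap\mathcal T$ implies $T\in\mathcal T$; it is *prime* if this holds for every finite non-empty $\mathcal T\subseteq Th_{\mathcal L}$. A set of expressions is *consistent* if it is contained in some theory. Expressions $a,b$ are *logically equivalent* if they belong to the same theories. An *intuitionistic abstract logic* is an abstract logic $\mathcal L$ in which the union of every non-empty chain of theories is a theory, with connectives $\vee,\wedge,\sim,\rightarrow,\top,\bot$ such that for all expressions $a,b$ and all totally prime theories $T$: - $a\vee b\in T$ iff $a\in T$ or $b\in T$; - $a\wedge b\in T$ iff $a\in T$ and $b\in T$; - $\sim a\in T$ iff $T\cup\{a\}$ is not consistent; - $a\rightarrow b\in T$ iff for every totally prime $T'\supseteq T$, $a\in T'$ implies $b\in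 T'$; - $\top\in T$ and $\bot\notin T$. A map $h:Expr_{\mathcal L}\to Expr_{\mathcal L'}$ is a *strongly stable logic map* if $h^{-1}(T')$ is a theory of $\mathcal L$ for every theory $T'$ of $\mathcal L'$, $h^{-1}(P')$ is prime for every prime theory $P'$ of $\mathcal L'$, and whenever $P'$, $P$ are prime theories of $\mathcal L'$, $\mathcal L$ with $h^{-1}(P')\subseteq P$, there is a prime theory $Q'\supseteq P'$ of $\mathcal L'$ with $h^{-1}(Q')=P$. Let $\mathcal{LI}$ be the category whose objects are the intuitionistic abstract logics and whose morphisms are the strongly stable logic maps, where, equality of expressions being understood as logical equivalence, two maps $h,g:\mathcal L\to\mathcal L'$ are the same morphism if $h(a)$ and $g(a)$ are logically equivalent for every $a\in Expr_{\mathcal L}$. Let $\mathcal{Esa}$ be the category whose objects are the non-empty Esakia spaces, that is, non-empty compact topological spaces $X$ with a partial order such that whenever $x\not\le y$ there is a clopen up-set containing $x$ but not $y$, and such that the down-set generated by any clopen set is clopen. Its morphisms are the Esakia morphisms: the continuous order-preserving maps $f:X\to Y$ such that $f(x)\le y$ implies $f(z)=y$ for some $z\ge x$. **Corollary 4.10.**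 The categories $\mathcal{LI}$ and $\mathcal{Esa}$ are dually equivalent, i.e. $\mathcal{LI}^{\mathrm{op}}$ is equivalent to $\mathcal{Esa}$. -/

import Mathlib

universe u

/-- An abstract logic: a set of expressions with a non-empty family of theories that is closed
under intersections of non-empty subfamilies. The connectives are added below, in the structure
`IntuitionisticLogic`. -/
structure AbstractLogic : Type (u + 1) where
  Expr : Type u
  Th : Set (Set Expr)
  th_nonempty : Th.Nonempty
  sInter_mem : ∀ 𝒯 : Set (Set Expr), 𝒯 ⊆ Th → 𝒯.Nonempty → ⋂₀ 𝒯 ∈ Th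

namespace AbstractLogic

variable (L : AbstractLogic.{u})

/-- A set of expressions is consistent if it is contained in some theory. -/
def Consistent (A : Set L.Expr) : Prop :=
  ∃ T ∈ L.Th, A ⊆ T

/-- The consequence relation `A ⊩ a`. -/
def Entails (A : Set L.Expr) (a : L.Expr) : Prop :=
  a ∈ ⋂₀ {T | T ∈ L.Th ∧ A ⊆ T}

/-- Logical equivalence: `a ⊩ b` and `b ⊩ a`. -/
def Equivalent (a b : L.Expr) : Prop :=
  L.Entails {a} b ∧ L.Entails {b} a

/-- The prime (that is, `ω`-prime) theories: those that are not the intersection of a non-empty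
finite set of other theories. -/
def PTh : Set (Set L.Expr) :=
  {T | T ∈ L.Th ∧
    ∀ 𝒯 : Set (Set L.Expr), 𝒯 ⊆ L.Th → 𝒯.Nonempty → 𝒯.Finite → T = ⋂₀ 𝒯 → T ∈ 𝒯}

/-- The totally prime theories: those that are not the intersection of a non-empty set, of any
cardinality, of other theories. -/
def TPTh : Set (Set L.Expr) :=
  {T | T ∈ L.Th ∧ ∀ 𝒯 : Set (Set L.Expr), 𝒯 ⊆ L.Th → 𝒯.Nonempty → T = ⋂₀ 𝒯 → T ∈ 𝒯}

/-- The union of every non-empty chain of theories is a theory. -/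
def ClosedUnderChains : Prop :=
  ∀ C : Set (Set L.Expr), C ⊆ L.Th → C.Nonempty → IsChain (· ⊆ ·) C → ⋃₀ C ∈ L.Th

variable {L} {L' L'' : AbstractLogic.{u}}

/-- Logic applications: the inverse image of every theory is a theory. -/
def IsLogicApplication (h : L.Expr → L'.Expr) : Prop :=
  ∀ T' ∈ L'.Th, h ⁻¹' T' ∈ L.Th

/-- Stable logic applications: moreover, the inverse image of every prime theory is prime. -/
def IsStable (h : L.Expr → L'.Expr) : Prop :=
  IsLogicApplication h ∧ ∀ P' ∈ L'.PTh, h ⁻¹' P' ∈ L.PTh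

/-- Strongly stable logic applications. -/
def IsStronglyStable (h : L.Expr → L'.Expr) : Prop :=
  IsStable h ∧ ∀ P' ∈ L'.PTh, ∀ P ∈ L.PTh, h ⁻¹' P' ⊆ P →
    ∃ Q' ∈ L'.PTh, P' ⊆ Q' ∧ h ⁻¹' Q' = P

theorem equivalent_iff {a b : L.Expr} :
    L.Equivalent a b ↔ ∀ T ∈ L.Th, a ∈ T ↔ b ∈ T := by
  simp only [Equivalent, Entails, Set.mem_sInter, Set.mem_ofPred_eq, Set.singleton_subset_iff]
  exact ⟨fun h T hT => ⟨fun ha => h.1 T ⟨hT, ha⟩, fun hb => h.2 T ⟨hT, hb⟩⟩,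
    fun h => ⟨fun T hT => (h T hT.1).1 hT.2, fun T hT => (h T hT.1).2 hT.2⟩⟩

theorem IsLogicApplication.map_equivalent {h : L.Expr → L'.Expr} (hh : IsLogicApplication h)
    {a b : L.Expr} (hab : L.Equivalent a b) : L'.Equivalent (h a) (h b) :=
  equivalent_iff.2 fun T' hT' => equivalent_iff.1 hab _ (hh T' hT')

theorem isStronglyStable_id : IsStronglyStable (id : L.Expr → L.Expr) :=
  ⟨⟨fun _ hT => hT, fun _ hP => hP⟩, fun _ _ P hP hle => ⟨P, hP, hle, rfl⟩⟩

theorem IsStronglyStable.comp {g : L'.Expr → L''.Expr} {h : L.Expr → L'.Expr}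
    (hg : IsStronglyStable g) (hh : IsStronglyStable h) : IsStronglyStable (g ∘ h) := by
  refine ⟨⟨fun T hT => hh.1.1 _ (hg.1.1 T hT), fun P hP => hh.1.2 _ (hg.1.2 P hP)⟩, ?_⟩
  intro P'' hP'' P hP hle
  obtain ⟨Q', hQ', hle', rfl⟩ := hh.2 _ (hg.1.2 P'' hP'') P hP hle
  obtain ⟨Q'', hQ'', hle'', rfl⟩ := hg.2 P'' hP'' Q' hQ' hle'
  exact ⟨Q'', hQ'', hle'', rfl⟩

end AbstractLogic

/-- Intuitionistic abstract logics: abstract logics closed under unions of chains, with connectives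
that are characterized by their behaviour on the totally prime theories. -/
structure IntuitionisticLogic : Type (u + 1) extends AbstractLogic.{u} where
  closedUnderChains : toAbstractLogic.ClosedUnderChains
  disj : Expr → Expr → Expr
  conj : Expr → Expr → Expr
  neg : Expr → Expr
  imp : Expr → Expr → Expr
  verum : Expr
  falsum : Expr
  disj_mem_iff : ∀ a b : Expr, ∀ T ∈ toAbstractLogic.TPTh, disj a b ∈ T ↔ a ∈ T ∨ b ∈ T
  conj_mem_iff : ∀ a b : Expr, ∀ T ∈ toAbstractLogic.TPTh, conj a b ∈ T ↔ a ∈ T ∧ b ∈ T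
  neg_mem_iff : ∀ a : Expr, ∀ T ∈ toAbstractLogic.TPTh,
    neg a ∈ T ↔ ¬ toAbstractLogic.Consistent (T ∪ {a})
  imp_mem_iff : ∀ a b : Expr, ∀ T ∈ toAbstractLogic.TPTh,
    imp a b ∈ T ↔ ∀ T' ∈ toAbstractLogic.TPTh, T ⊆ T' → a ∈ T' → b ∈ T'
  verum_mem : ∀ T ∈ toAbstractLogic.TPTh, verum ∈ T
  falsum_notMem : ∀ T ∈ toAbstractLogic.TPTh, falsum ∉ T

/-- Strongly stable logic maps between intuitionistic abstract logics. -/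
def StronglyStableMap (L L' : IntuitionisticLogic.{u}) : Type u :=
  {h : L.Expr → L'.Expr // AbstractLogic.IsStronglyStable
    (L := L.toAbstractLogic) (L' := L'.toAbstractLogic) h}

/-- Equality of expressions in a logic is logical equivalence; accordingly, two strongly stable
maps are equal as morphisms if their values are logically equivalent at every expression. -/
instance StronglyStableMap.setoid (L L' : IntuitionisticLogic.{u}) :
    Setoid (StronglyStableMap L L') where
  r f g := ∀ a : L.Expr, L'.toAbstractLogic.Equivalent (f.1 a) (g.1 a)
  iseqv :=
    { refl := fun _ _ => ⟨fun _ hT => hT.2 rfl, fun _ hT => hT.2 rfl⟩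
      symm := fun h a => ⟨(h a).2, (h a).1⟩
      trans := fun h k a => AbstractLogic.equivalent_iff.2 fun T hT =>
        (AbstractLogic.equivalent_iff.1 (h a) T hT).trans
          (AbstractLogic.equivalent_iff.1 (k a) T hT) }

/-- Composition of strongly stable maps, in diagrammatic order. -/
def StronglyStableMap.comp {L L' L'' : IntuitionisticLogic.{u}} (f : StronglyStableMap L L')
    (g : StronglyStableMap L' L'') : StronglyStableMap L L'' :=
  ⟨g.1 ∘ f.1, g.2.comp f.2⟩

/-- The category of intuitionistic abstract logics and strongly stable logic maps (up to logical
equivalence of their values). -/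
abbrev LI : Type (u + 1) := IntuitionisticLogic.{u}

instance LI.category : CategoryTheory.Category.{u} LI.{u} where
  Hom L L' := Quotient (StronglyStableMap.setoid L L')
  id L := Quotient.mk _ ⟨id, AbstractLogic.isStronglyStable_id⟩
  comp := Quotient.map₂ StronglyStableMap.comp (by
    intro f f' hf g g' hg a
    exact AbstractLogic.equivalent_iff.2 fun T hT =>
      (AbstractLogic.equivalent_iff.1 (g.2.1.1.map_equivalent (hf a)) T hT).trans
        (AbstractLogic.equivalent_iff.1 (hg (f'.1 a)) T hT))
  id_comp f := Quotient.inductionOn f fun _ => rfl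
  comp_id f := Quotient.inductionOn f fun _ => rfl
  assoc f g h := Quotient.inductionOn₃ f g h fun _ _ _ => rfl

/-- Esakia spaces: compact ordered spaces with the Priestley separation property, in which the
down-set generated by a clopen set is clopen. -/
structure Esa : Type (u + 1) where
  carrier : Type u
  [topologicalSpace : TopologicalSpace carrier]
  [partialOrder : PartialOrder carrier]
  [compactSpace : CompactSpace carrier]
  [priestleySpace : PriestleySpace carrier]
  isClopen_lowerClosure : ∀ U : Set carrier, IsClopen U → IsClopen (lowerClosure U : Set carrier)

attribute [instance] Esa.topologicalSpace Esa.partialOrder Esa.compactSpace Esa.priestleySpace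

/-- The category of Esakia spaces and Esakia morphisms (continuous order-preserving maps `f` such
that `f x ≤ y` implies `f z = y` for some `z ≥ x`). -/
instance Esa.category : CategoryTheory.Category.{u} Esa.{u} where
  Hom X Y := EsakiaHom X.carrier Y.carrier
  id X := EsakiaHom.id X.carrier
  comp f g := EsakiaHom.comp g f

/-- The property of an Esakia space of being non-empty. -/
def Esa.IsNonempty : CategoryTheory.ObjectProperty Esa.{u} :=
  fun X => Nonempty X.carrier

/-!
The duality sends a logic `L` to the space `PrimeTheory L` of its prime theories, ordered by
inclusion and topologized as a subspace of the Cantor cube `L.Expr → Bool`, and a strongly stable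
map `h` to `P ↦ h ⁻¹' P`. This contravariant functor is faithful, full and essentially surjective.

*Theories.* By Zorn's lemma, every theory is the intersection of the totally prime theories above
it (`IntuitionisticLogic.mem_iff_forall_TPTh`), so the clauses for the connectives make the theories
exactly the proper filters of expressions (`IntuitionisticLogic.mem_Th_of_filter`), and the prime
theories the prime filters (`IntuitionisticLogic.mem_PTh_iff`). The latter are cut out by closed
conditions in the Cantor cube, whence compactness. The sets `{P | a ∈ P}` separate points, and by
compactness they are all the clopen upper sets (`PrimeTheory.exists_eq_setOf_mem`); every clopen set
is a finite union of sets `{P | a ∈ P ∧ b ∉ P}`, and the down-set of such a set is the complement of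
`{P | a → b ∈ P}`.

*Faithful and full.* Prime theories separate expressions up to logical equivalence. Conversely, an
Esakia morphism `f` pulls `{P | a ∈ P}` back to some `{P | h a ∈ P}`; then `h ⁻¹' P = f P` for
prime `P`, and `h` is strongly stable because theories are intersections of prime ones
(`StronglyStableMap.comap_surjective`).

*Essentially surjective.* For a non-empty Esakia space `X`, the clopen upper sets are the
expressions of a logic whose theories are the sets `{U | A ⊆ U}` with `A` non-empty
(`Esa.logic`). By compactness, its prime theories are exactly those with `A` a point
(`Esa.pointTheory_surjective`).
-/

/-! ### Theories of an intuitionistic logic -/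

namespace AbstractLogic

variable {L : AbstractLogic.{u}}

theorem entails_singleton_iff {a b : L.Expr} :
    L.Entails {a} b ↔ ∀ T ∈ L.Th, a ∈ T → b ∈ T := by
  simp only [Entails, Set.mem_sInter, Set.mem_ofPred_eq, Set.singleton_subset_iff, and_imp]

theorem TPTh_subset_PTh : L.TPTh ⊆ L.PTh :=
  fun _ hT => ⟨hT.1, fun 𝒯 h𝒯 hne _ heq => hT.2 𝒯 h𝒯 hne heq⟩

/-- A theory that is maximal among those omitting `b` is totally prime; such theories exist by
Zorn's lemma. -/
theorem ClosedUnderChains.exists_TPTh (hL : L.ClosedUnderChains) {T : Set L.Expr}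
    (hT : T ∈ L.Th) {b : L.Expr} (hb : b ∉ T) : ∃ P ∈ L.TPTh, T ⊆ P ∧ b ∉ P := by
  obtain ⟨P, hTP, hP⟩ := zorn_subset_nonempty {S | S ∈ L.Th ∧ b ∉ S} (by
    intro c hc hchain hne
    refine ⟨⋃₀ c, ⟨hL c (fun S hS => (hc hS).1) hne hchain, ?_⟩,
      fun S hS => Set.subset_sUnion_of_mem hS⟩
    rintro ⟨S, hS, hbS⟩
    exact (hc hS).2 hbS) T ⟨hT, hb⟩
  refine ⟨P, ⟨hP.prop.1, fun 𝒯 h𝒯 _ heq => ?_⟩, hTP, hP.prop.2⟩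
  obtain ⟨S, hS, hbS⟩ : ∃ S ∈ 𝒯, b ∉ S := by
    by_contra! h
    exact hP.prop.2 (heq ▸ Set.mem_sInter.2 h)
  have hPS : P ⊆ S := heq ▸ Set.sInter_subset_of_mem hS
  rwa [hPS.antisymm (hP.le_of_ge ⟨h𝒯 hS, hbS⟩ hPS)]

end AbstractLogic

namespace IntuitionisticLogic

variable {L : IntuitionisticLogic.{u}} {T P : Set L.Expr} {a b : L.Expr}

theorem exists_TPTh (hT : T ∈ L.Th) (hb : b ∉ T) :
    ∃ P ∈ L.TPTh, T ⊆ P ∧ b ∉ P :=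
  L.closedUnderChains.exists_TPTh hT hb

theorem mem_iff_forall_TPTh (hT : T ∈ L.Th) :
    b ∈ T ↔ ∀ P ∈ L.TPTh, T ⊆ P → b ∈ P := by
  refine ⟨fun hb P _ hTP => hTP hb, fun h => ?_⟩
  by_contra hb
  obtain ⟨P, hP, hTP, hbP⟩ := exists_TPTh hT hb
  exact hbP (h P hP hTP)

/-- No theory contains `⊥`. In particular the set of all expressions is not a theory, as it would
be totally prime. -/
theorem falsum_notMem_of_mem_Th (hT : T ∈ L.Th) : L.falsum ∉ T := by
  intro hf
  by_cases hu : T = Set.univ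
  · refine L.falsum_notMem T ⟨hT, fun 𝒯 _ ⟨S, hS⟩ heq => ?_⟩ hf
    have hTS : T ⊆ S := heq ▸ Set.sInter_subset_of_mem hS
    rwa [hTS.antisymm (hu ▸ Set.subset_univ S)]
  · obtain ⟨b, hb⟩ := (Set.ne_univ_iff_exists_notMem T).1 hu
    obtain ⟨P, hP, hTP, -⟩ := exists_TPTh hT hb
    exact L.falsum_notMem P hP (hTP hf)

theorem verum_mem_of_mem_Th (hT : T ∈ L.Th) : L.verum ∈ T :=
  (mem_iff_forall_TPTh hT).2 fun P hP _ => L.verum_mem P hP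

theorem conj_mem_iff_of_mem_Th (hT : T ∈ L.Th) : L.conj a b ∈ T ↔ a ∈ T ∧ b ∈ T := by
  refine ⟨fun h => ⟨(mem_iff_forall_TPTh hT).2 fun P hP hTP => ?_,
    (mem_iff_forall_TPTh hT).2 fun P hP hTP => ?_⟩,
    fun h => (mem_iff_forall_TPTh hT).2 fun P hP hTP => ?_⟩
  · exact ((L.conj_mem_iff a b P hP).1 (hTP h)).1
  · exact ((L.conj_mem_iff a b P hP).1 (hTP h)).2
  · exact (L.conj_mem_iff a b P hP).2 ⟨hTP h.1, hTP h.2⟩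

theorem disj_mem_of_mem_Th (hT : T ∈ L.Th) (h : a ∈ T ∨ b ∈ T) : L.disj a b ∈ T :=
  (mem_iff_forall_TPTh hT).2 fun P hP hTP =>
    (L.disj_mem_iff a b P hP).2 (h.imp (@hTP a) (@hTP b))

theorem imp_mem_iff_of_mem_Th (hT : T ∈ L.Th) :
    L.imp a b ∈ T ↔ ∀ P ∈ L.TPTh, T ⊆ P → a ∈ P → b ∈ P := by
  rw [mem_iff_forall_TPTh hT]
  refine ⟨fun h P hP hTP => (L.imp_mem_iff a b P hP).1 (h P hP hTP) P hP subset_rfl,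
    fun h P hP hTP => (L.imp_mem_iff a b P hP).2 fun Q hQ hPQ => h Q hQ (hTP.trans hPQ)⟩

/-- A prime theory `P` containing `a ∨ b` is the intersection of two theories, generated by
`P ∪ {a}` and by `P ∪ {b}`, hence is one of them. -/
theorem disj_mem_iff_of_mem_PTh (hP : P ∈ L.PTh) : L.disj a b ∈ P ↔ a ∈ P ∨ b ∈ P := by
  refine ⟨fun h => ?_, disj_mem_of_mem_Th hP.1⟩
  by_contra! hab
  have key : ∀ Q ∈ L.TPTh, P ⊆ Q → a ∈ Q ∨ b ∈ Q := fun Q hQ hPQ =>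
    (L.disj_mem_iff a b Q hQ).1 (hPQ h)
  let A : L.Expr → Set (Set L.Expr) := fun c => {Q | Q ∈ L.TPTh ∧ P ⊆ Q ∧ c ∈ Q}
  have hA : ∀ c, (A c).Nonempty → ⋂₀ A c ∈ L.Th := fun c hc =>
    L.sInter_mem _ (fun Q hQ => hQ.1.1) hc
  have ha : ⋂₀ A a ∈ L.Th := hA a (by
    obtain ⟨Q, hQ, hPQ, hbQ⟩ := exists_TPTh hP.1 hab.2
    exact ⟨Q, hQ, hPQ, (key Q hQ hPQ).resolve_right hbQ⟩)
  have hb : ⋂₀ A b ∈ L.Th := hA b (by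
    obtain ⟨Q, hQ, hPQ, haQ⟩ := exists_TPTh hP.1 hab.1
    exact ⟨Q, hQ, hPQ, (key Q hQ hPQ).resolve_left haQ⟩)
  have hmem : ∀ c, c ∈ ⋂₀ A c := fun c => Set.mem_sInter.2 fun Q hQ => hQ.2.2
  have hsub : ∀ c, P ⊆ ⋂₀ A c := fun c => Set.subset_sInter fun Q hQ => hQ.2.1
  have heq : P = ⋂₀ {⋂₀ A a, ⋂₀ A b} := by
    rw [Set.sInter_pair]
    refine (Set.subset_inter (hsub a) (hsub b)).antisymm fun c hc => ?_
    refine (mem_iff_forall_TPTh hP.1).2 fun Q hQ hPQ => ?_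
    rcases key Q hQ hPQ with h | h
    · exact hc.1 Q ⟨hQ, hPQ, h⟩
    · exact hc.2 Q ⟨hQ, hPQ, h⟩
  rcases hP.2 _ (Set.pair_subset ha hb) (Set.insert_nonempty _ _) (Set.toFinite _) heq with h | h
  · exact hab.1 (h ▸ hmem a)
  · exact hab.2 ((Set.mem_singleton_iff.1 h) ▸ hmem b)

theorem mem_PTh_of_disj (hT : T ∈ L.Th) (h : ∀ a b, L.disj a b ∈ T → a ∈ T ∨ b ∈ T) :
    T ∈ L.PTh := by
  refine ⟨hT, fun 𝒯 h𝒯 hne hfin heq => ?_⟩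
  by_contra hT𝒯
  -- A finite disjunction of expressions in `S \ T`, for `S ∈ 𝒯`, lies in `⋂₀ 𝒯` but not in `T`.
  have key : ∃ c ∉ T, ∀ S ∈ 𝒯, c ∈ S := by
    have hsub : ∀ S ∈ 𝒯, S ∈ L.Th ∧ ∃ c ∈ S, c ∉ T := fun S hS => by
      refine ⟨h𝒯 hS, ?_⟩
      by_contra! hST
      have hTS : T ⊆ S := heq ▸ Set.sInter_subset_of_mem hS
      exact hT𝒯 (hTS.antisymm hST ▸ hS)
    clear heq hT𝒯 h𝒯 hne
    induction 𝒯, hfin using Set.Finite.induction_on with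
    | empty => exact ⟨L.falsum, falsum_notMem_of_mem_Th hT, fun _ hS => hS.elim⟩
    | @insert S 𝒯 _ _ ih =>
      obtain ⟨c, hc, hc𝒯⟩ := ih fun R hR => hsub R (Set.mem_insert_of_mem _ hR)
      obtain ⟨hS, d, hd, hdT⟩ := hsub S (Set.mem_insert _ _)
      refine ⟨L.disj d c, fun hdc => (h d c hdc).elim hdT hc, ?_⟩
      rintro R (rfl | hR)
      · exact disj_mem_of_mem_Th hS (.inl hd)
      · exact disj_mem_of_mem_Th (hsub R (Set.mem_insert_of_mem _ hR)).1 (.inr (hc𝒯 R hR))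
  obtain ⟨c, hcT, hc⟩ := key
  exact hcT (heq ▸ Set.mem_sInter.2 hc)

/-- Proper filters are theories. For `a ∉ F`, a theory `G` that is maximal among those containing
no `f → a` with `f ∈ F` contains `F` and omits `a`. -/
theorem mem_Th_of_filter {F : Set L.Expr} (hv : L.verum ∈ F) (hf : L.falsum ∉ F)
    (hc : ∀ a b, a ∈ F → b ∈ F → L.conj a b ∈ F)
    (he : ∀ a b, L.Entails {a} b → a ∈ F → b ∈ F) : F ∈ L.Th := by
  have key : ∀ a ∉ F, ∃ G ∈ L.Th, F ⊆ G ∧ a ∉ G := by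
    intro a ha
    have hbot : ⋂₀ L.Th ∈ L.Th := L.sInter_mem _ subset_rfl L.th_nonempty
    obtain ⟨G, -, hG⟩ := zorn_subset_nonempty {G | G ∈ L.Th ∧ ∀ f ∈ F, L.imp f a ∉ G} (by
      intro c hc' hchain hne
      refine ⟨⋃₀ c, ⟨L.closedUnderChains c (fun S hS => (hc' hS).1) hne hchain, ?_⟩,
        fun S hS => Set.subset_sUnion_of_mem hS⟩
      rintro f hfF ⟨S, hS, hfS⟩
      exact (hc' hS).2 f hfF hfS) (⋂₀ L.Th) ⟨hbot, fun f hfF hfa => ha (he f a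
        (AbstractLogic.entails_singleton_iff.2 fun T hT hfT =>
          (mem_iff_forall_TPTh hT).2 fun P hP hTP => (imp_mem_iff_of_mem_Th hbot).1 hfa P hP
            (Set.sInter_subset_of_mem hP.1) (hTP hfT)) hfF)⟩
    obtain ⟨hGT, hGa⟩ := hG.prop
    refine ⟨G, hGT, fun f hfF => ?_, fun haG => hGa L.verum hv
      ((imp_mem_iff_of_mem_Th hGT).2 fun P _ hGP _ => hGP haG)⟩
    let 𝒯 : Set (Set L.Expr) := {T | T ∈ L.Th ∧ G ⊆ T ∧ f ∈ T}
    have hne : 𝒯.Nonempty := by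
      by_contra hne
      refine hGa f hfF ((imp_mem_iff_of_mem_Th hGT).2 fun P hP hGP hfP => ?_)
      exact (hne ⟨P, hP.1, hGP, hfP⟩).elim
    have h𝒯 : ⋂₀ 𝒯 ∈ L.Th := L.sInter_mem _ (fun T hT => hT.1) hne
    refine hG.le_of_ge ⟨h𝒯, fun g hg hga => ?_⟩ (Set.subset_sInter fun T hT => hT.2.1)
      (Set.mem_sInter.2 fun T hT => hT.2.2)
    refine hGa _ (hc g f hg hfF) ((imp_mem_iff_of_mem_Th hGT).2 fun P hP hGP hgf => ?_)
    obtain ⟨hgP, hfP⟩ := (L.conj_mem_iff g f P hP).1 hgf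
    exact (imp_mem_iff_of_mem_Th h𝒯).1 hga P hP
      (Set.sInter_subset_of_mem ⟨hP.1, hGP, hfP⟩) hgP
  have heq : F = ⋂₀ {G | G ∈ L.Th ∧ F ⊆ G} := by
    refine (Set.subset_sInter fun G hG => hG.2).antisymm fun a ha => ?_
    by_contra haF
    obtain ⟨G, hG, hFG, haG⟩ := key a haF
    exact haG (ha G ⟨hG, hFG⟩)
  obtain ⟨G, hG, hFG, -⟩ := key _ hf
  exact heq ▸ L.sInter_mem _ (fun G hG => hG.1) ⟨G, hG, hFG⟩

theorem mem_PTh_iff : P ∈ L.PTh ↔ L.verum ∈ P ∧ L.falsum ∉ P ∧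
    (∀ a b, a ∈ P → b ∈ P → L.conj a b ∈ P) ∧ (∀ a b, L.Entails {a} b → a ∈ P → b ∈ P) ∧
    ∀ a b, L.disj a b ∈ P → a ∈ P ∨ b ∈ P := by
  refine ⟨fun h => ⟨verum_mem_of_mem_Th h.1, falsum_notMem_of_mem_Th h.1,
    fun a b ha hb => (conj_mem_iff_of_mem_Th h.1).2 ⟨ha, hb⟩,
    fun a b hab => AbstractLogic.entails_singleton_iff.1 hab P h.1,
    fun a b => (disj_mem_iff_of_mem_PTh h).1⟩, fun ⟨hv, hf, hc, he, hd⟩ => ?_⟩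
  exact mem_PTh_of_disj (mem_Th_of_filter hv hf hc he) hd

end IntuitionisticLogic

/-! ### The Esakia space of prime theories -/

/-- The space of prime theories of `L`, ordered by inclusion. Its topology is the one of pointwise
convergence of indicator functions, in which the sets `{P | a ∈ P}` are clopen. -/
def PrimeTheory (L : IntuitionisticLogic.{u}) : Type u :=
  L.PTh

namespace PrimeTheory

open Topology

variable {L : IntuitionisticLogic.{u}}

instance : SetLike (PrimeTheory L) L.Expr where
  coe P := P.1
  coe_injective := Subtype.val_injective

instance : PartialOrder (PrimeTheory L) := .ofSetLike (PrimeTheory L) L.Expr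

theorem mem_PTh (P : PrimeTheory L) : (P : Set L.Expr) ∈ L.PTh :=
  P.2

theorem mem_Th (P : PrimeTheory L) : (P : Set L.Expr) ∈ L.Th :=
  P.2.1

open Classical in
/-- The indicator function of a prime theory. -/
noncomputable def indicator (P : PrimeTheory L) : L.Expr → Bool :=
  fun a => decide (a ∈ P)

theorem indicator_eq_true_iff {P : PrimeTheory L} {a : L.Expr} :
    P.indicator a = true ↔ a ∈ P := by
  simp [indicator]

noncomputable instance : TopologicalSpace (PrimeTheory L) :=
  .induced indicator inferInstance

theorem continuous_iff {X : Type*} [TopologicalSpace X] {f : X → PrimeTheory L} :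
    Continuous f ↔ ∀ a, IsClopen {x | a ∈ f x} := by
  rw [continuous_induced_rng, continuous_pi_iff]
  refine forall_congr' fun a => ?_
  have h : {x | a ∈ f x} = (fun x => (indicator ∘ f) x a) ⁻¹' {true} := by
    ext x
    simp [indicator_eq_true_iff]
  rw [h]
  exact ⟨fun hf => (isClopen_discrete _).preimage hf, fun h => by
    rw [continuous_bool_rng true]; exact h⟩

theorem isClopen_setOf_mem (a : L.Expr) : IsClopen {P : PrimeTheory L | a ∈ P} :=
  continuous_iff.1 continuous_id a

theorem range_indicator : Set.range (indicator (L := L)) =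
    {x | {a | x a = true} ∈ L.PTh} := by
  ext x
  constructor
  · rintro ⟨P, rfl⟩
    simpa only [Set.mem_ofPred_eq, indicator_eq_true_iff] using! P.mem_PTh
  · intro hx
    refine ⟨⟨_, hx⟩, funext fun a => ?_⟩
    exact Bool.eq_iff_iff.2 indicator_eq_true_iff

/-- The conditions defining prime theories are closed, so prime theories form a closed subspace of
the Cantor cube. -/
theorem isClosed_range_indicator : IsClosed (Set.range (indicator (L := L))) := by
  have h : ∀ a : L.Expr, IsClopen {x : L.Expr → Bool | x a = true} := fun a =>
    (isClopen_discrete {true}).preimage (continuous_apply a)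
  have himp : ∀ {p q : (L.Expr → Bool) → Prop}, IsClopen {x | p x} → IsClopen {x | q x} →
      IsClopen {x | p x → q x} := fun {p q} hp hq => by
    have : {x | p x → q x} = {x | p x}ᶜ ∪ {x | q x} := by
      ext x; exact imp_iff_not_or
    rw [this]
    exact hp.compl.union hq
  rw [range_indicator]
  simp only [IntuitionisticLogic.mem_PTh_iff, Set.mem_ofPred_eq, Set.ofPred_and, Set.ofPred_forall]
  refine (h _).isClosed.inter <| (h _).compl.isClosed.inter <|
    (isClosed_iInter fun a => isClosed_iInter fun b => ?_).inter <|
    (isClosed_iInter fun a => isClosed_iInter fun b => isClosed_iInter fun _ => ?_).inter <|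
    isClosed_iInter fun a => isClosed_iInter fun b => ?_
  · exact (himp (h a) (himp (h b) (h _))).isClosed
  · exact (himp (h a) (h b)).isClosed
  · exact (himp (h _) ((h a).union (h b))).isClosed

theorem isClosedEmbedding_indicator : IsClosedEmbedding (indicator (L := L)) where
  eq_induced := rfl
  injective P Q h := SetLike.ext fun a => by
    rw [← indicator_eq_true_iff, h, indicator_eq_true_iff]
  isClosed_range := isClosed_range_indicator

instance : CompactSpace (PrimeTheory L) :=
  isClosedEmbedding_indicator.compactSpace

theorem exists_mem_notMem_of_not_le {P Q : PrimeTheory L} (h : ¬ P ≤ Q) : ∃ a ∈ P, a ∉ Q :=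
  Set.not_subset.1 h

instance : PriestleySpace (PrimeTheory L) where
  priestley {P Q} h := by
    obtain ⟨a, haP, haQ⟩ := exists_mem_notMem_of_not_le h
    exact ⟨_, isClopen_setOf_mem a, fun R S hRS haR => hRS haR, haP, haQ⟩

instance : Nonempty (PrimeTheory L) := by
  obtain ⟨T, hT⟩ := L.th_nonempty
  obtain ⟨P, hP, -⟩ := IntuitionisticLogic.exists_TPTh hT
    (IntuitionisticLogic.falsum_notMem_of_mem_Th hT)
  exact ⟨⟨P, AbstractLogic.TPTh_subset_PTh hP⟩⟩

variable (P : PrimeTheory L) {a b : L.Expr}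

theorem verum_mem : L.verum ∈ P :=
  IntuitionisticLogic.verum_mem_of_mem_Th P.mem_Th

theorem falsum_notMem : L.falsum ∉ P :=
  IntuitionisticLogic.falsum_notMem_of_mem_Th P.mem_Th

theorem conj_mem_iff : L.conj a b ∈ P ↔ a ∈ P ∧ b ∈ P :=
  IntuitionisticLogic.conj_mem_iff_of_mem_Th P.mem_Th

theorem disj_mem_iff : L.disj a b ∈ P ↔ a ∈ P ∨ b ∈ P :=
  IntuitionisticLogic.disj_mem_iff_of_mem_PTh P.mem_PTh

theorem imp_mem_iff : L.imp a b ∈ P ↔ ∀ Q : PrimeTheory L, P ≤ Q → a ∈ Q → b ∈ Q := by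
  refine ⟨fun h Q hPQ haQ => ?_, fun h => ?_⟩
  · exact (IntuitionisticLogic.mem_iff_forall_TPTh Q.mem_Th).2 fun R hR hQR =>
      (IntuitionisticLogic.imp_mem_iff_of_mem_Th P.mem_Th).1 h R hR
        (Set.Subset.trans hPQ hQR) (hQR haQ)
  · exact (IntuitionisticLogic.imp_mem_iff_of_mem_Th P.mem_Th).2 fun R hR hPR =>
      h ⟨R, AbstractLogic.TPTh_subset_PTh hR⟩ hPR

variable {P}

/-- The sets `{P | a ∈ P ∧ b ∉ P}` form a basis of the topology. -/
theorem exists_basic_subset {U : Set (PrimeTheory L)} (hU : IsOpen U) (hP : P ∈ U) :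
    ∃ a ∈ P, ∃ b ∉ P, {Q : PrimeTheory L | a ∈ Q ∧ b ∉ Q} ⊆ U := by
  have key : ∃ a ∈ P, ∃ b ∉ P, ∀ Q ∈ Uᶜ, a ∈ Q → b ∈ Q := by
    refine hU.isClosed_compl.isCompact.induction_on
      (p := fun s => ∃ a ∈ P, ∃ b ∉ P, ∀ Q ∈ s, a ∈ Q → b ∈ Q)
      ⟨L.verum, P.verum_mem, L.falsum, P.falsum_notMem, fun _ h => h.elim⟩ ?_ ?_ ?_
    · rintro s t hst ⟨a, ha, b, hb, h⟩
      exact ⟨a, ha, b, hb, fun Q hQ => h Q (hst hQ)⟩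
    · rintro s t ⟨a, ha, b, hb, h⟩ ⟨a', ha', b', hb', h'⟩
      refine ⟨L.conj a a', P.conj_mem_iff.2 ⟨ha, ha'⟩, L.disj b b',
        fun h => (P.disj_mem_iff.1 h).elim hb hb', ?_⟩
      rintro Q hQ haQ
      rw [Q.conj_mem_iff] at haQ
      exact Q.disj_mem_iff.2 (hQ.imp (fun hs => h Q hs haQ.1) fun ht => h' Q ht haQ.2)
    · intro Q hQ
      have hPQ : P ≠ Q := fun h => hQ (h ▸ hP)
      obtain h | h := hPQ.not_le_or_not_ge
      · obtain ⟨a, haP, haQ⟩ := exists_mem_notMem_of_not_le h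
        exact ⟨{R | a ∈ R}ᶜ, mem_nhdsWithin_of_mem_nhds
          ((isClopen_setOf_mem a).compl.isOpen.mem_nhds haQ), a, haP, L.falsum, P.falsum_notMem,
          fun R hR haR => (hR haR).elim⟩
      · obtain ⟨b, hbQ, hbP⟩ := exists_mem_notMem_of_not_le h
        exact ⟨{R | b ∈ R}, mem_nhdsWithin_of_mem_nhds
          ((isClopen_setOf_mem b).isOpen.mem_nhds hbQ), L.verum, P.verum_mem, b, hbP,
          fun R hR _ => hR⟩
  obtain ⟨a, ha, b, hb, h⟩ := key
  refine ⟨a, ha, b, hb, fun Q hQ => ?_⟩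
  by_contra hQU
  exact hQ.2 (h Q hQU hQ.1)

theorem lowerClosure_basic (a b : L.Expr) :
    (lowerClosure {Q : PrimeTheory L | a ∈ Q ∧ b ∉ Q} : Set (PrimeTheory L)) =
      {P : PrimeTheory L | L.imp a b ∈ P}ᶜ := by
  ext P
  simp only [SetLike.mem_coe, mem_lowerClosure, Set.mem_compl_iff, Set.mem_ofPred_eq,
    imp_mem_iff]
  push Not
  exact exists_congr fun Q => by tauto

theorem isClopen_lowerClosure {U : Set (PrimeTheory L)} (hU : IsClopen U) :
    IsClopen (lowerClosure U : Set (PrimeTheory L)) := by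
  -- `U` is a finite union of basic clopen sets.
  have key : ∃ W, U ⊆ W ∧ W ⊆ U ∧ IsClopen (lowerClosure W : Set (PrimeTheory L)) := by
    refine hU.isClosed.isCompact.induction_on
      (p := fun s => ∃ W, s ⊆ W ∧ W ⊆ U ∧ IsClopen (lowerClosure W : Set (PrimeTheory L)))
      ⟨∅, subset_rfl, Set.empty_subset _, by simpa using! isClopen_empty⟩ ?_ ?_ ?_
    · rintro s t hst ⟨W, htW, hW⟩
      exact ⟨W, hst.trans htW, hW⟩
    · rintro s t ⟨V, hsV, hVU, hV⟩ ⟨W, htW, hWU, hW⟩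
      refine ⟨V ∪ W, Set.union_subset_union hsV htW, Set.union_subset hVU hWU, ?_⟩
      rw [lowerClosure_union, LowerSet.coe_sup]
      exact hV.union hW
    · intro P hP
      obtain ⟨a, ha, b, hb, hab⟩ := exists_basic_subset hU.isOpen hP
      refine ⟨{Q | a ∈ Q ∧ b ∉ Q}, mem_nhdsWithin_of_mem_nhds (IsOpen.mem_nhds
        ((isClopen_setOf_mem a).isOpen.inter (isClopen_setOf_mem b).compl.isOpen) ⟨ha, hb⟩),
        _, subset_rfl, hab, ?_⟩
      rw [lowerClosure_basic]
      exact (isClopen_setOf_mem _).compl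
  obtain ⟨W, hUW, hWU, hW⟩ := key
  rwa [hUW.antisymm hWU]

/-- Every clopen upper set of prime theories is represented by an expression. -/
theorem exists_eq_setOf_mem {U : Set (PrimeTheory L)} (hU : IsClopen U) (hU' : IsUpperSet U) :
    ∃ a : L.Expr, U = {P : PrimeTheory L | a ∈ P} := by
  have h₁ : ∀ P ∈ U, ∃ a ∈ P, ∀ Q ∈ Uᶜ, a ∉ Q := by
    intro P hP
    refine hU.compl.isClosed.isCompact.induction_on (p := fun s => ∃ a ∈ P, ∀ Q ∈ s, a ∉ Q)
      ⟨L.verum, P.verum_mem, fun _ h => h.elim⟩ ?_ ?_ ?_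
    · rintro s t hst ⟨a, ha, h⟩
      exact ⟨a, ha, fun Q hQ => h Q (hst hQ)⟩
    · rintro s t ⟨a, ha, h⟩ ⟨b, hb, h'⟩
      refine ⟨L.conj a b, P.conj_mem_iff.2 ⟨ha, hb⟩, ?_⟩
      rintro Q hQ hab
      rw [Q.conj_mem_iff] at hab
      exact hQ.elim (fun hs => h Q hs hab.1) fun ht => h' Q ht hab.2
    · intro Q hQ
      obtain ⟨a, haP, haQ⟩ := exists_mem_notMem_of_not_le fun hPQ : P ≤ Q => hQ (hU' hPQ hP)
      exact ⟨{R | a ∈ R}ᶜ, mem_nhdsWithin_of_mem_nhds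
        ((isClopen_setOf_mem a).compl.isOpen.mem_nhds haQ), a, haP, fun R hR => hR⟩
  have h₂ : ∃ a : L.Expr, U ⊆ {P | a ∈ P} ∧ {P : PrimeTheory L | a ∈ P} ⊆ U := by
    refine hU.isClosed.isCompact.induction_on
      (p := fun s => ∃ a : L.Expr, s ⊆ {P | a ∈ P} ∧ {P : PrimeTheory L | a ∈ P} ⊆ U)
      ⟨L.falsum, Set.empty_subset _, fun P hP => (P.falsum_notMem hP).elim⟩ ?_ ?_ ?_
    · rintro s t hst ⟨a, hta, ha⟩
      exact ⟨a, hst.trans hta, ha⟩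
    · rintro s t ⟨a, hsa, ha⟩ ⟨b, htb, hb⟩
      exact ⟨L.disj a b, fun P hP => P.disj_mem_iff.2 (hP.imp (@hsa P) (@htb P)),
        fun P hP => (P.disj_mem_iff.1 hP).elim (@ha P) (@hb P)⟩
    · intro P hP
      obtain ⟨a, haP, ha⟩ := h₁ P hP
      refine ⟨{R | a ∈ R}, mem_nhdsWithin_of_mem_nhds
        ((isClopen_setOf_mem a).isOpen.mem_nhds haP), a, subset_rfl, fun Q hQ => ?_⟩
      by_contra hQU
      exact ha Q hQU hQ
  obtain ⟨a, ha⟩ := h₂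
  exact ⟨a, ha.1.antisymm ha.2⟩

end PrimeTheory

/-! ### The logic of an Esakia space -/

namespace Esa

open TopologicalSpace

variable {X : Esa.{u}}

/-- The set of clopen upper sets that contain `A`. -/
def theoryOf (A : Set X.carrier) : Set (ClopenUpperSet X.carrier) :=
  {U | A ⊆ U}

/-- The set of points that lie in all members of `T`. -/
def models (T : Set (ClopenUpperSet X.carrier)) : Set X.carrier :=
  {x | ∀ U ∈ T, x ∈ U}

theorem subset_models_theoryOf (A : Set X.carrier) : A ⊆ models (theoryOf A) :=
  fun _ hx _ hU => hU hx

theorem theoryOf_models_theoryOf (A : Set X.carrier) :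
    theoryOf (models (theoryOf A)) = theoryOf A :=
  Set.Subset.antisymm (fun _ hU => (subset_models_theoryOf A).trans hU) fun U hU _ hx => hx U hU

theorem isClosed_models (T : Set (ClopenUpperSet X.carrier)) : IsClosed (models T) := by
  have : models T = ⋂ U ∈ T, (U : Set X.carrier) := by
    ext x
    simp [models]
  rw [this]
  exact isClosed_biInter fun U _ => U.isClopen.isClosed

theorem models_anti {S T : Set (ClopenUpperSet X.carrier)} (h : S ⊆ T) : models T ⊆ models S :=
  fun _ hx U hU => hx U (h hU)

theorem theoryOf_singleton_subset_iff {x y : X.carrier} :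
    theoryOf {x} ⊆ theoryOf {y} ↔ x ≤ y := by
  simp only [theoryOf, Set.singleton_subset_iff, SetLike.mem_coe]
  refine ⟨fun h => ?_, fun h U hx => U.upper h hx⟩
  by_contra hxy
  obtain ⟨U, hU, hU', hx, hy⟩ := exists_isClopen_upper_of_not_le hxy
  exact hy (h (a := ⟨⟨U, hU⟩, hU'⟩) hx)

variable (X) in
/-- The theories of the logic of clopen upper sets of `X`: the sets `theoryOf A` with `A` non-empty.
These are the proper filters of clopen upper sets, but the description by subsets of `X` makes the
totally prime ones visibly of the form `theoryOf {x}`. -/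
def theories : Set (Set (ClopenUpperSet X.carrier)) :=
  {T | ∃ A : Set X.carrier, A.Nonempty ∧ theoryOf A = T}

theorem theoryOf_models {T : Set (ClopenUpperSet X.carrier)} (hT : T ∈ X.theories) :
    theoryOf (models T) = T := by
  obtain ⟨A, -, rfl⟩ := hT
  exact theoryOf_models_theoryOf A

theorem models_nonempty {T : Set (ClopenUpperSet X.carrier)} (hT : T ∈ X.theories) :
    (models T).Nonempty := by
  obtain ⟨A, hA, rfl⟩ := hT
  exact hA.mono (subset_models_theoryOf A)

variable (X) in
/-- The abstract logic of clopen upper sets of a non-empty Esakia space. -/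
abbrev abstractLogic (hX : Nonempty X.carrier) : AbstractLogic.{u} where
  Expr := ClopenUpperSet X.carrier
  Th := X.theories
  th_nonempty := ⟨_, {hX.some}, Set.singleton_nonempty _, rfl⟩
  sInter_mem 𝒯 h𝒯 := by
    rintro ⟨S, hS⟩
    refine ⟨⋃ T ∈ 𝒯, models T, ?_, ?_⟩
    · exact (models_nonempty (h𝒯 hS)).mono (Set.subset_biUnion_of_mem (u := models) hS)
    · ext U
      simp only [theoryOf, Set.mem_ofPred_eq, Set.iUnion_subset_iff, Set.mem_sInter]
      refine forall₂_congr fun T hT => ?_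
      conv_rhs => rw [← theoryOf_models (h𝒯 hT)]
      rfl

variable {hX : Nonempty X.carrier}

/-- By compactness, a clopen upper set containing the intersection of a chain of closed sets
contains one of them. -/
theorem closedUnderChains_abstractLogic : (X.abstractLogic hX).ClosedUnderChains := by
  intro C hC hne hchain
  have : Nonempty C := hne.to_subtype
  have hdir : Directed (· ⊇ ·) fun T : C => models T.1 := fun S T => by
    rcases hchain.total S.2 T.2 with h | h
    · exact ⟨T, models_anti h, subset_rfl⟩
    · exact ⟨S, subset_rfl, models_anti h⟩
  refine ⟨⋂ T : C, models T.1, ?_, ?_⟩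
  · exact IsCompact.nonempty_iInter_of_directed_nonempty_isCompact_isClosed _ hdir
      (fun T => models_nonempty (hC T.2)) (fun T => (isClosed_models _).isCompact)
      fun T => isClosed_models _
  · ext U
    constructor
    · intro hU
      obtain ⟨T, hT⟩ := U.isClopen.compl.isClosed.isCompact.elim_directed_family_closed
        (fun T : C => models T.1) (fun T => isClosed_models _) (by
          rw [← Set.disjoint_iff_inter_eq_empty, Set.disjoint_compl_left_iff_subset]
          exact hU) hdir
      rw [← Set.disjoint_iff_inter_eq_empty, Set.disjoint_compl_left_iff_subset] at hT
      exact ⟨T, T.2, theoryOf_models (hC T.2) ▸ hT⟩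
    · rintro ⟨T, hT, hUT⟩ x hx
      exact Set.mem_iInter.1 hx ⟨T, hT⟩ U hUT

theorem exists_of_mem_TPTh {T : Set (ClopenUpperSet X.carrier)}
    (hT : T ∈ (X.abstractLogic hX).TPTh) : ∃ x, theoryOf {x} = T := by
  obtain ⟨⟨A, hA, rfl⟩, h⟩ := hT
  obtain ⟨x, -, hx⟩ := h ((fun x => theoryOf {x}) '' A)
    (by rintro _ ⟨x, -, rfl⟩; exact ⟨{x}, Set.singleton_nonempty x, rfl⟩) (hA.image _)
    (by
      ext U
      rw [Set.sInter_image, Set.mem_iInter₂]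
      simp only [theoryOf, Set.mem_ofPred_eq, Set.singleton_subset_iff]
      exact Iff.rfl)
  exact ⟨x, hx⟩

theorem mem_theoryOf_singleton {x : X.carrier} {U : ClopenUpperSet X.carrier} :
    U ∈ theoryOf {x} ↔ x ∈ U :=
  Set.singleton_subset_iff

/-- The Heyting implication of clopen upper sets: the complement of the down-set of `U \ V`. -/
def himp (U V : ClopenUpperSet X.carrier) : ClopenUpperSet X.carrier where
  carrier := (lowerClosure (U \ V : Set X.carrier) : Set X.carrier)ᶜ
  isClopen' := (X.isClopen_lowerClosure _ (U.isClopen.diff V.isClopen)).compl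
  upper' := (lowerClosure _).lower.compl

theorem mem_himp {U V : ClopenUpperSet X.carrier} {x : X.carrier} :
    x ∈ himp U V ↔ ∀ y, x ≤ y → y ∈ U → y ∈ V := by
  change x ∉ lowerClosure (U \ V : Set X.carrier) ↔ _
  rw [mem_lowerClosure]
  push Not
  exact forall_congr' fun y => by
    simp only [Set.mem_sdiff, SetLike.mem_coe]
    tauto

variable (X) in
/-- The intuitionistic logic of clopen upper sets of a non-empty Esakia space. -/
abbrev logic (hX : Nonempty X.carrier) : IntuitionisticLogic.{u} where
  toAbstractLogic := X.abstractLogic hX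
  closedUnderChains := closedUnderChains_abstractLogic
  disj := max (α := ClopenUpperSet X.carrier)
  conj := min (α := ClopenUpperSet X.carrier)
  neg U := himp U ⊥
  imp := himp
  verum := (⊤ : ClopenUpperSet X.carrier)
  falsum := (⊥ : ClopenUpperSet X.carrier)
  disj_mem_iff U V T hT := by
    obtain ⟨x, rfl⟩ := exists_of_mem_TPTh hT
    simp only [mem_theoryOf_singleton]
    exact Iff.rfl
  conj_mem_iff U V T hT := by
    obtain ⟨x, rfl⟩ := exists_of_mem_TPTh hT
    simp only [mem_theoryOf_singleton]
    exact Iff.rfl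
  neg_mem_iff U T hT := by
    obtain ⟨x, rfl⟩ := exists_of_mem_TPTh hT
    rw [mem_theoryOf_singleton, mem_himp]
    constructor
    · rintro h ⟨_, ⟨A, ⟨y, hy⟩, rfl⟩, hA⟩
      have hAy : theoryOf A ⊆ theoryOf {y} := fun V hV => Set.singleton_subset_iff.2 (hV hy)
      exact h y (theoryOf_singleton_subset_iff.1 ((Set.subset_union_left.trans hA).trans hAy))
        (hA (Set.mem_union_right _ rfl) hy)
    · intro h y hxy hy
      refine (h ⟨theoryOf {y}, ⟨_, Set.singleton_nonempty y, rfl⟩, ?_⟩).elim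
      exact Set.union_subset (theoryOf_singleton_subset_iff.2 hxy)
        (Set.singleton_subset_iff.2 (mem_theoryOf_singleton.2 hy))
  imp_mem_iff U V T hT := by
    obtain ⟨x, rfl⟩ := exists_of_mem_TPTh hT
    rw [mem_theoryOf_singleton, mem_himp]
    constructor
    · intro h T' hT' hle hU
      obtain ⟨y, rfl⟩ := exists_of_mem_TPTh hT'
      exact mem_theoryOf_singleton.2
        (h y (theoryOf_singleton_subset_iff.1 hle) (mem_theoryOf_singleton.1 hU))
    · intro h y hxy hy
      by_contra hyV
      -- `theoryOf {y}` need not be totally prime, but it extends to a totally prime theory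
      -- omitting `V`.
      obtain ⟨P, hP, hyP, hVP⟩ := closedUnderChains_abstractLogic.exists_TPTh
        (L := X.abstractLogic hX) (T := theoryOf {y}) ⟨_, Set.singleton_nonempty y, rfl⟩
        (b := V) (fun h => hyV (mem_theoryOf_singleton.1 h))
      exact hVP (h P hP ((theoryOf_singleton_subset_iff.2 hxy).trans hyP)
        (hyP (mem_theoryOf_singleton.2 hy)))
  verum_mem T hT := by
    obtain ⟨x, rfl⟩ := exists_of_mem_TPTh hT
    exact mem_theoryOf_singleton.2 (Set.mem_univ x)
  falsum_notMem T hT := by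
    obtain ⟨x, rfl⟩ := exists_of_mem_TPTh hT
    exact fun h => mem_theoryOf_singleton.1 h

variable (hX) in
/-- The prime theory of the clopen upper sets containing `x`. -/
def pointTheory (x : X.carrier) : PrimeTheory (X.logic hX) :=
  ⟨theoryOf {x}, IntuitionisticLogic.mem_PTh_of_disj ⟨_, Set.singleton_nonempty x, rfl⟩
    fun U V h => (mem_theoryOf_singleton.1 h : x ∈ (U : Set X.carrier) ∪ V).imp
      mem_theoryOf_singleton.2 mem_theoryOf_singleton.2⟩

theorem mem_pointTheory {x : X.carrier} {U : ClopenUpperSet X.carrier} :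
    U ∈ pointTheory hX x ↔ x ∈ U :=
  mem_theoryOf_singleton

theorem pointTheory_le_iff {x y : X.carrier} : pointTheory hX x ≤ pointTheory hX y ↔ x ≤ y :=
  theoryOf_singleton_subset_iff

/-- If a prime theory `P` is not given by a point, every point of `models P` lies in a clopen
upper set outside `P`. Finitely many of these cover `models P`, so that `P` is a finite
intersection of theories each of which contains one of them. -/
theorem pointTheory_surjective : Function.Surjective (pointTheory hX) := by
  intro P
  by_contra! hne
  let T : Set (ClopenUpperSet X.carrier) := P.1
  have hT : T ∈ X.theories := P.mem_Th
  have key : ∀ x : X.carrier, ∃ U : ClopenUpperSet X.carrier, x ∈ models T → x ∈ U ∧ U ∉ T := by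
    intro x
    by_cases hx : x ∈ models T
    · have : ¬ theoryOf {x} ⊆ T := fun h => hne x <| SetLike.coe_injective <|
        Set.Subset.antisymm h fun U hU => mem_theoryOf_singleton.2 (hx U hU)
      obtain ⟨U, hxU, hU⟩ := Set.not_subset.1 this
      exact ⟨U, fun _ => ⟨mem_theoryOf_singleton.1 hxU, hU⟩⟩
    · exact ⟨⊤, fun h => (hx h).elim⟩
  choose U hU using key
  obtain ⟨b, hb, hbfin, hcov⟩ := (isClosed_models T).isCompact.elim_finite_subcover_image
    (b := models T) (c := fun x => (U x : Set X.carrier)) (fun x _ => (U x).isClopen.isOpen)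
    fun x hx => Set.mem_biUnion hx (hU x hx).1
  have hbne : b.Nonempty := by
    obtain ⟨x, hx⟩ := models_nonempty hT
    obtain ⟨y, hy, -⟩ := Set.mem_iUnion₂.1 (hcov hx)
    exact ⟨y, hy⟩
  obtain ⟨x, hx, hxT⟩ := P.mem_PTh.2 ((fun x => theoryOf (models T ∩ U x)) '' b)
    (by
      rintro _ ⟨x, hx, rfl⟩
      exact ⟨models T ∩ U x, ⟨x, hb hx, (hU x (hb hx)).1⟩, rfl⟩)
    (hbne.image _) (hbfin.image _)
    (by
      refine (show T = _ from ?_)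
      conv_lhs => rw [← theoryOf_models hT]
      ext V
      rw [Set.sInter_image, Set.mem_iInter₂]
      refine ⟨fun h x _ => Set.inter_subset_left.trans h, fun h y hy => ?_⟩
      obtain ⟨x, hx, hyx⟩ := Set.mem_iUnion₂.1 (hcov hy)
      exact h x hx ⟨hy, hyx⟩)
  have hmem : U x ∈ theoryOf (models T ∩ U x) := Set.inter_subset_right
  exact (hU x (hb hx)).2 (show U x ∈ T from hxT.subset hmem)

theorem continuous_pointTheory : Continuous (pointTheory hX) :=
  PrimeTheory.continuous_iff.2 fun U : ClopenUpperSet X.carrier => by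
    have : {x | U ∈ pointTheory hX x} = (U : Set X.carrier) :=
      Set.ext fun x => mem_pointTheory (hX := hX)
    exact this ▸ U.isClopen

variable (hX) in
/-- A non-empty Esakia space is order isomorphic to the space of prime theories of its logic. -/
noncomputable def pointOrderIso : X.carrier ≃o PrimeTheory (X.logic hX) where
  toEquiv := Equiv.ofBijective (pointTheory hX)
    ⟨fun _ _ h => le_antisymm (pointTheory_le_iff.1 h.le) (pointTheory_le_iff.1 h.ge),
      pointTheory_surjective⟩
  map_rel_iff' := pointTheory_le_iff

theorem continuous_pointOrderIso : Continuous (pointOrderIso hX) :=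
  continuous_pointTheory

theorem continuous_pointOrderIso_symm : Continuous (pointOrderIso hX).symm :=
  Continuous.continuous_symm_of_equiv_compact_to_t2 (f := (pointOrderIso hX).toEquiv)
    continuous_pointTheory

end Esa

/-! ### The duality -/

open CategoryTheory Opposite

namespace StronglyStableMap

variable {L L' : IntuitionisticLogic.{u}}

/-- The Esakia morphism between spaces of prime theories induced by a strongly stable map. -/
def comap (h : StronglyStableMap L L') : EsakiaHom (PrimeTheory L') (PrimeTheory L) where
  toFun P := ⟨h.1 ⁻¹' P, h.2.1.2 P P.mem_PTh⟩
  monotone' P Q hPQ := Set.preimage_mono (s := (P : Set L'.Expr)) (t := Q) hPQ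
  continuous_toFun := PrimeTheory.continuous_iff.2 fun a =>
    PrimeTheory.isClopen_setOf_mem (h.1 a)
  exists_map_eq_of_map_le' P Q hPQ := by
    obtain ⟨R, hR, hPR, hRQ⟩ := h.2.2 P P.mem_PTh Q Q.mem_PTh hPQ
    exact ⟨⟨R, hR⟩, hPR, SetLike.coe_injective hRQ⟩

/-- Theories are intersections of prime theories, so that two maps inducing the same Esakia
morphism have logically equivalent values. -/
theorem comap_eq_comap_iff {h g : StronglyStableMap L L'} : h.comap = g.comap ↔ h ≈ g := by
  constructor
  · intro heq a
    have key : ∀ P ∈ L'.TPTh, h.1 a ∈ P ↔ g.1 a ∈ P := fun P hP => by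
      let Q : PrimeTheory L' := ⟨P, AbstractLogic.TPTh_subset_PTh hP⟩
      have : a ∈ h.comap Q ↔ a ∈ g.comap Q := by rw [heq]
      exact this
    refine AbstractLogic.equivalent_iff.2 fun T hT => ?_
    rw [IntuitionisticLogic.mem_iff_forall_TPTh hT, IntuitionisticLogic.mem_iff_forall_TPTh hT]
    exact forall₂_congr fun P hP => imp_congr_right fun _ => key P hP
  · intro hhg
    exact EsakiaHom.ext fun P => SetLike.ext fun a =>
      AbstractLogic.equivalent_iff.1 (hhg a) P P.mem_Th

/-- An Esakia morphism `f` pulls the clopen upper set represented by `a` back to one represented by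
some expression `h a`; then `h` is strongly stable and induces `f`. -/
theorem comap_surjective : Function.Surjective (comap (L := L) (L' := L')) := by
  intro f
  have key : ∀ a : L.Expr, ∃ b : L'.Expr, ∀ P : PrimeTheory L', b ∈ P ↔ a ∈ f P := fun a => by
    obtain ⟨b, hb⟩ := PrimeTheory.exists_eq_setOf_mem
      (PrimeTheory.continuous_iff.1 f.continuous_toFun a) fun P Q hPQ haP => f.monotone' hPQ haP
    exact ⟨b, fun P => (Set.ext_iff.1 hb P).symm⟩
  choose h hh using key
  have hpre : ∀ P : PrimeTheory L', h ⁻¹' P = f P := fun P => Set.ext fun a => hh a P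
  refine ⟨⟨h, ⟨fun T hT => ?_, fun P hP => ?_⟩, fun P hP Q hQ hPQ => ?_⟩,
    EsakiaHom.ext fun P => SetLike.coe_injective (hpre P)⟩
  · let 𝒯 : Set (Set L.Expr) := {S | ∃ P ∈ L'.TPTh, T ⊆ P ∧ h ⁻¹' P = S}
    have heq : h ⁻¹' T = ⋂₀ 𝒯 := by
      ext a
      rw [Set.mem_preimage, IntuitionisticLogic.mem_iff_forall_TPTh hT]
      simp only [Set.mem_sInter, 𝒯]
      constructor
      · rintro ha _ ⟨P, hP, hTP, rfl⟩
        exact ha P hP hTP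
      · exact fun ha P hP hTP => ha _ ⟨P, hP, hTP, rfl⟩
    rw [heq]
    refine L.sInter_mem _ ?_ ?_
    · rintro _ ⟨P, hP, -, rfl⟩
      rw [show h ⁻¹' P = f ⟨P, AbstractLogic.TPTh_subset_PTh hP⟩ from hpre ⟨P, _⟩]
      exact PrimeTheory.mem_Th _
    · obtain ⟨P, hP, hTP, -⟩ := IntuitionisticLogic.exists_TPTh hT
        (IntuitionisticLogic.falsum_notMem_of_mem_Th hT)
      exact ⟨_, P, hP, hTP, rfl⟩
  · rw [show h ⁻¹' P = f ⟨P, hP⟩ from hpre ⟨P, hP⟩]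
    exact PrimeTheory.mem_PTh _
  · rw [show h ⁻¹' P = f ⟨P, hP⟩ from hpre ⟨P, hP⟩] at hPQ
    obtain ⟨R, hPR, hR⟩ :=
      f.exists_map_eq_of_map_le' (a := (⟨P, hP⟩ : PrimeTheory L')) (b := ⟨Q, hQ⟩) hPQ
    exact ⟨R, R.mem_PTh, hPR, (hpre R).trans (congrArg SetLike.coe hR)⟩

end StronglyStableMap

/-- The Esakia space of prime theories of an intuitionistic logic. -/
noncomputable def Esa.ofLogic (L : IntuitionisticLogic.{u}) : Esa.{u} where
  carrier := PrimeTheory L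
  isClopen_lowerClosure _ := PrimeTheory.isClopen_lowerClosure

/-- The Esakia morphism induced by a morphism of logics, that is, by a class of strongly stable
maps. -/
def LI.comap {L L' : LI.{u}} (f : L ⟶ L') : EsakiaHom (PrimeTheory L') (PrimeTheory L) :=
  Quotient.lift StronglyStableMap.comap (fun _ _ => StronglyStableMap.comap_eq_comap_iff.2) f

theorem LI.comap_comp {L L' L'' : LI.{u}} (f : L ⟶ L') (g : L' ⟶ L'') :
    comap (f ≫ g) = (comap f).comp (comap g) :=
  Quotient.inductionOn₂ f g fun _ _ => rfl

theorem LI.comap_injective {L L' : LI.{u}} :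
    Function.Injective (comap : (L ⟶ L') → EsakiaHom (PrimeTheory L') (PrimeTheory L)) :=
  fun f g => Quotient.inductionOn₂ f g fun _ _ h =>
    Quotient.sound (StronglyStableMap.comap_eq_comap_iff.1 h)

/-- The contravariant functor sending a logic to its space of prime theories and a strongly stable
map to the preimage map. -/
noncomputable def primeTheoryFunctor : LI.{u}ᵒᵖ ⥤ Esa.IsNonempty.{u}.FullSubcategory where
  obj L := ⟨Esa.ofLogic L.unop, inferInstanceAs (Nonempty (PrimeTheory L.unop))⟩
  map f := ObjectProperty.homMk (LI.comap f.unop)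
  map_id _ := rfl
  map_comp f g := ObjectProperty.hom_ext _ (LI.comap_comp g.unop f.unop)

instance : primeTheoryFunctor.{u}.Faithful where
  map_injective hfg := Quiver.Hom.unop_inj (LI.comap_injective (congrArg (·.hom) hfg))

instance : primeTheoryFunctor.{u}.Full where
  map_surjective {L L'} f := by
    obtain ⟨h, hh⟩ := StronglyStableMap.comap_surjective f.hom
    exact ⟨Quiver.Hom.op (Quotient.mk _ h), ObjectProperty.hom_ext _ hh⟩

/-- An order isomorphism that is a homeomorphism is an isomorphism of Esakia spaces. -/
def Esa.isoMk {X Y : Esa.{u}} (e : X.carrier ≃o Y.carrier) (he : Continuous e)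
    (he' : Continuous e.symm) : X ≅ Y where
  hom := (⟨⟨e.toOrderEmbedding.toOrderHom, he⟩, fun _ y h =>
    ⟨e.symm y, e.le_symm_apply.2 h, e.apply_symm_apply y⟩⟩ : EsakiaHom X.carrier Y.carrier)
  inv := (⟨⟨e.symm.toOrderEmbedding.toOrderHom, he'⟩, fun _ x h =>
    ⟨e x, e.symm_apply_le.1 h, e.symm_apply_apply x⟩⟩ : EsakiaHom Y.carrier X.carrier)
  hom_inv_id := EsakiaHom.ext fun x => e.symm_apply_apply x
  inv_hom_id := EsakiaHom.ext fun y => e.apply_symm_apply y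

instance : primeTheoryFunctor.{u}.EssSurj where
  mem_essImage X := ⟨op (X.obj.logic X.property), ⟨(ObjectProperty.isoMk _ (Esa.isoMk
    (Y := Esa.ofLogic (X.obj.logic X.property)) (Esa.pointOrderIso X.property)
    Esa.continuous_pointOrderIso Esa.continuous_pointOrderIso_symm)).symm⟩⟩

theorem corollary4p10 :
    Nonempty (CategoryTheory.Equivalence LI.{u}ᵒᵖ Esa.IsNonempty.{u}.FullSubcategory) := by
  have : primeTheoryFunctor.{u}.IsEquivalence := {}
  exact ⟨primeTheoryFunctor.asEquivalence⟩
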